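/- **The queue.** Let $m\ge 1$, $g_1\ge 0$, $g_2\ge 1$, $r\ge 0$ be integers and $c=g_1+g_2+r$. Time is divided into cycles of $c$ slots: slots $1,\dots,g_1$ (green, blockages possible), $g_1+1,\dots,g_1+g_2$ (green, no blockages), $g_1+g_2+1,\dots,c$ (red). Let $p_i,q_i\in[0,1]$ for $1\le i\le g_1$. In slot $i$, $Y_i$ vehicles arrive; $Y_{i,b}\le Y_i$ is the number of them that get blocked if the queue was empty and pedestrians are crossing. Pedestrians cross in slot $i$ with probability $q_i$, and a batch that newly gets to the head of the queue in slot $i$ turns with probability $p_i$; all of these, and different slots, are independent (only $Y_i$ and $Y_{i,b}$ may depend on each other). The state is $(X,S)$, where $X$ is the number of delayed vehicles and $S\in\{u,b\}$ (unblocked, blocked). In slot $i\le g_1$: if $X=0$, then the new state is $(Y_{i,b},b)$ if pedestrians cross and $Y_{i,b}>0$, and $(0,u)$ otherwise; if $X>0$ and pedestrians cross and either $S=b$ or the batch at the head is a newly arrived turning batch, then the new state is $(X+Y_i,b)$; in all other cases the slot is *served*: the new state is $(X-m+Y_i,u)$ if $X\ge m$ and $(0,u)$ if $X<m$, and $\min(X,m)$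 delayed vehicles depart. Each slot $g_1<i\le g_1+g_2$ is served. In a red slot, $X$ becomes $X+Y_i$. **Capacity and stability.** The *capacity* is the supremum, over the queue length $x$ at the start of a cycle, of the mean number of delayed vehicles that depart during the cycle. The queue is *stable* if the Markov chain on $\{0,1,2,\dots\}$ of queue lengths at the ends of successive cycles is positive recurrent, in the sense that there is a finite set $C$ of queue lengths with $\mathbb E_x[\min\{n\ge1: X_n\in C\}]<\infty$ for every initial queue length $x$. **The reward recursion.** Put $r_{c+1}=0$, and $$r_i=r_{i+1}\quad(g_1+g_2<i\le c),\qquad r_i=m+r_{i+1}\quad(g_1<i\le g_1+g_2),$$ (so that $r_c=0$ if $r\ge1$); if $g_1\ge 1$, put $$r_{g_1,b}=r_{g_1+1},\qquad r_{g_1,u}=m+r_{g_1+1},$$ $$r_{i,b}=q_{i+1}r_{i+1,b}+(1-q_{i+1})r_{i+1,u},\qquad r_{i,u}=m+p_{i+1}q_{i+1}r_{i+1,b}+(1-p_{i+1}q_{i+1})r_{i+1,u}\quad(1\le i<g_1),$$ and finally $r_0=p_1q_1r_{1,b}+(1-p_1q_1)r_{1,u}$ (and $r_0=r_1$ if $g_1=0$).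 **Theorem.** (1) The capacity equals $r_0$; moreover, the mean number of delayed vehicles that depart during a cycle equals $r_0$ for every cycle that starts with at least $m(g_1+g_2)$ delayed vehicles. (2) The queue is stable if and only if $\sum_{i=1}^{c}\mathbb E[Y_i]<r_0$. (3) If the queue is stable, then there is a steady-state (stationary) distribution of the queue length at the end of a cycle. -/

import Mathlib

open scoped ENNReal

noncomputable section

/-- The input parameters of the bFCTL queue with multiple lanes. Slots of a cycle are numbered
`1, …, c` with `c = g1 + g2 + r`; the values of `p` and `q` are used in the slots `1, …, g1` only. -/
structure BFCTL where
  /-- Maximal size of a departing batch (number of lanes). -/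
  m : ℕ
  /-- Length of the first part of the green period, in which blockages may occur. -/
  g1 : ℕ
  /-- Length of the second part of the green period, without blockages. -/
  g2 : ℕ
  /-- Length of the red period. -/
  r : ℕ
  m_pos : 0 < m
  g2_pos : 0 < g2
  /-- `p i`: probability that a batch that newly gets to the head of the queue in slot `i` turns. -/
  p : ℕ → unitInterval
  /-- `q i`: probability that pedestrians cross in slot `i`. -/
  q : ℕ → unitInterval
  /-- Joint law of `(Y_i, Y_{i,b})`: the number of vehicles arriving in slot `i`, and how many of
  them get blocked if the queue was empty and pedestrians are crossing (the first turning vehicle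
  and all arrivals behind it). -/
  arr : ℕ → PMF (ℕ × ℕ)
  arr_le : ∀ i, ∀ a ∈ (arr i).support, a.2 ≤ a.1

namespace BFCTL

/-- The law of a coin that shows `true` with probability `p`. -/
def coin (p : unitInterval) : PMF Bool :=
  PMF.ofFintype (fun b => if b then ENNReal.ofReal p else ENNReal.ofReal (1 - p)) (by
    rw [Fintype.sum_bool]
    simp only [if_true, Bool.false_eq_true, if_false]
    rw [← ENNReal.ofReal_add p.2.1 (sub_nonneg.2 p.2.2)]
    simp)

/-- Cycle length. -/
def c (Q : BFCTL) : ℕ := Q.g1 + Q.g2 + Q.r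

/-- `E[Y_i]`, the mean number of arrivals in slot `i`. -/
def meanArrivals (Q : BFCTL) (i : ℕ) : ℝ≥0∞ := ∑' a : ℕ × ℕ, Q.arr i a * (a.1 : ℝ≥0∞)

/-! ### The dynamics of the queue -/

/-- Queue length after an unblocked green slot that starts with `x` delayed vehicles and has `y`
arrivals: if fewer than `m` delayed vehicles are present, all of them and all arrivals leave. -/
def serve (Q : BFCTL) (x y : ℕ) : ℕ := if x < Q.m then 0 else x - Q.m + y

/-- One slot. The state is (number of delayed vehicles, is the queue blocked?). Given the state at
the end of slot `i - 1`, the arrivals `(y, yb)`, whether a batch that newly gets to the head of the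
queue turns (`turn`) and whether pedestrians cross (`ped`), return the state at the end of slot `i`
together with the number of delayed vehicles that depart in slot `i`. -/
def update (Q : BFCTL) (i : ℕ) (s : ℕ × Bool) (y yb : ℕ) (turn ped : Bool) : (ℕ × Bool) × ℕ :=
  if i ≤ Q.g1 then
    if s.1 = 0 then
      if ped = true ∧ 0 < yb then ((yb, true), 0) else ((0, false), 0)
    else if ped = true ∧ (s.2 = true ∨ turn = true) then ((s.1 + y, true), 0)
    else ((Q.serve s.1 y, false), min s.1 Q.m)
  else if i ≤ Q.g1 + Q.g2 then ((Q.serve s.1 y, false), min s.1 Q.m)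
  else ((s.1 + y, false), 0)

/-- Law of the outcome of slot `i`: arrivals, turning and pedestrians are independent. -/
def slotLaw (Q : BFCTL) (i : ℕ) (s : ℕ × Bool) : PMF ((ℕ × Bool) × ℕ) :=
  (Q.arr i).bind fun a => (coin (Q.p i)).bind fun turn => (coin (Q.q i)).map fun ped =>
    Q.update i s a.1 a.2 turn ped

/-- Law of (state at the end of slot `i`, number of delayed vehicles that departed in the slots
`1, …, i`) for a cycle that starts in state `s`; different slots are independent. -/
def run (Q : BFCTL) (s : ℕ × Bool) : ℕ → PMF ((ℕ × Bool) × ℕ)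
  | 0 => PMF.pure (s, 0)
  | i + 1 => (run Q s i).bind fun z => (Q.slotLaw (i + 1) z.1).map fun w => (w.1, z.2 + w.2)

/-- Law of the outcome of a full cycle that starts with `x` delayed vehicles. A cycle always starts
(and ends) unblocked, since blockages are removed in slot `g1 + 1`. -/
def cycle (Q : BFCTL) (x : ℕ) : PMF ((ℕ × Bool) × ℕ) := Q.run (x, false) Q.c

/-- Transition law of the Markov chain of queue lengths at the ends of successive cycles. -/
def cycleKernel (Q : BFCTL) (x : ℕ) : PMF ℕ := (Q.cycle x).map fun z => z.1.1

/-! ### Capacity -/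

/-- Mean number of delayed vehicles that depart during a cycle that starts with `x` of them. -/
def meanDepartures (Q : BFCTL) (x : ℕ) : ℝ≥0∞ := ∑' z, Q.cycle x z * (z.2 : ℝ≥0∞)

/-- The capacity: the maximal mean number of delayed vehicles that can depart in a cycle. -/
def capacity (Q : BFCTL) : ℝ≥0∞ := ⨆ x : ℕ, Q.meanDepartures x

/-! ### Stability -/

/-- `P_x(τ > n)`, where `τ = inf {k ≥ 1 : X_k ∈ C}` for the chain `X` with `X_0 = x` and transition
law `K`. -/
def survival (K : ℕ → PMF ℕ) (C : Finset ℕ) : ℕ → ℕ → ℝ≥0∞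
  | 0, _ => 1
  | n + 1, x => ∑' y, K x y * (if y ∈ C then 0 else survival K C n y)

/-- `E_x[τ] = ∑_{n ≥ 0} P_x(τ > n)`, the mean time to reach (or to return to) `C` from `x`. -/
def meanReturnTime (K : ℕ → PMF ℕ) (C : Finset ℕ) (x : ℕ) : ℝ≥0∞ := ∑' n, survival K C n x

/-- Stability, i.e. positive recurrence: some finite set of queue lengths is reached in finite mean
time from every queue length (and returned to in finite mean time). -/
def IsStable (Q : BFCTL) : Prop := ∃ C : Finset ℕ, ∀ x : ℕ, meanReturnTime Q.cycleKernel C x < ∞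

/-! ### The Markov reward recursion -/

/-- `r_i` for the states `i = g1 + 1, …, c`: reward `m` in each of the slots
`g1 + 1, …, g1 + g2`, none in the red slots, and nothing after slot `c`. -/
def lateReward (Q : BFCTL) (i : ℕ) : ℝ :=
  if Q.c < i then 0
  else (if i ≤ Q.g1 + Q.g2 then (Q.m : ℝ) else 0) + lateReward Q (i + 1)
termination_by Q.c + 1 - i

/-- `r_{i,b}` (`blocked = true`) and `r_{i,u}` (`blocked = false`) for `i = 1, …, g1`. -/
def earlyReward (Q : BFCTL) (blocked : Bool) (i : ℕ) : ℝ :=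
  if i < Q.g1 then
    if blocked = true then
      (Q.q (i + 1) : ℝ) * earlyReward Q true (i + 1)
        + (1 - (Q.q (i + 1) : ℝ)) * earlyReward Q false (i + 1)
    else
      Q.m + (Q.p (i + 1) : ℝ) * (Q.q (i + 1) : ℝ) * earlyReward Q true (i + 1)
        + (1 - (Q.p (i + 1) : ℝ) * (Q.q (i + 1) : ℝ)) * earlyReward Q false (i + 1)
  else if blocked = true then Q.lateReward (Q.g1 + 1)
  else Q.m + Q.lateReward (Q.g1 + 1)
termination_by Q.g1 - i

/-- `r_0`. -/
def r0 (Q : BFCTL) : ℝ :=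
  if Q.g1 = 0 then Q.lateReward 1
  else (Q.p 1 : ℝ) * (Q.q 1 : ℝ) * Q.earlyReward true 1
    + (1 - (Q.p 1 : ℝ) * (Q.q 1 : ℝ)) * Q.earlyReward false 1

end BFCTL

end

/-! Two potentials control a cycle. The future load (queue plus mean arrivals still to come)
accounts for vehicles: departures plus final queue have mean at most initial queue plus total
arrivals. The reward still to be collected (`toGo`) bounds mean departures by `r0`. Both bounds are
equalities when the cycle starts with at least `m * (g1 + g2)` vehicles, because the queue then
holds at least `m` at the start of every green slot. This gives the capacity, and it makes the drift
of the cycle chain exactly total mean arrivals minus `r0` outside a finite set.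

Negative drift gives finite mean return times by Foster's criterion
(`meanReturnTime_lt_top_of_drift`). Conversely, a chain that falls by a bounded amount per step and
has nonnegative drift high up has an infinite mean return time from some state
(`exists_meanReturnTime_eq_top`). The stationary law is a limit of Cesàro averages that keep mass on
a finite set (`exists_stationary_of_drift`); no irreducibility is needed. -/

/-- Expectation of a nonnegative function under a probability mass function. -/
noncomputable def PMF.expect {α : Type*} (P : PMF α) (f : α → ℝ≥0∞) : ℝ≥0∞ := ∑' a, P a * f a

namespace PMF

variable {α β : Type*}

theorem expect_pure (a : α) (f : α → ℝ≥0∞) : (PMF.pure a).expect f = f a := by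
  classical
  unfold expect
  rw [tsum_eq_single a]
  · simp
  · intro b hb
    simp [hb]

theorem expect_bind (P : PMF α) (g : α → PMF β) (f : β → ℝ≥0∞) :
    (P.bind g).expect f = P.expect fun a => (g a).expect f := by
  simp only [expect, PMF.bind_apply, ← ENNReal.tsum_mul_right, ← ENNReal.tsum_mul_left]
  rw [ENNReal.tsum_comm]
  simp only [mul_assoc]

theorem expect_map (P : PMF α) (g : α → β) (f : β → ℝ≥0∞) :
    (P.map g).expect f = P.expect fun a => f (g a) := by
  rw [← PMF.bind_pure_comp, expect_bind]
  simp only [Function.comp, expect_pure]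

theorem expect_add (P : PMF α) (f g : α → ℝ≥0∞) :
    (P.expect fun a => f a + g a) = P.expect f + P.expect g := by
  simp only [expect, mul_add, ENNReal.tsum_add]

theorem expect_const (P : PMF α) (k : ℝ≥0∞) : (P.expect fun _ => k) = k := by
  simp only [expect, ENNReal.tsum_mul_right, P.tsum_coe, one_mul]

theorem expect_mono_of_support (P : PMF α) {f g : α → ℝ≥0∞} (h : ∀ a ∈ P.support, f a ≤ g a) :
    P.expect f ≤ P.expect g := by
  refine ENNReal.tsum_le_tsum fun a => ?_
  by_cases ha : P a = 0
  · simp [ha]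
  · exact mul_le_mul_right (h a ha) _

theorem expect_congr_of_support (P : PMF α) {f g : α → ℝ≥0∞} (h : ∀ a ∈ P.support, f a = g a) :
    P.expect f = P.expect g :=
  le_antisymm (P.expect_mono_of_support fun a ha => (h a ha).le)
    (P.expect_mono_of_support fun a ha => (h a ha).ge)

theorem expect_mono (P : PMF α) {f g : α → ℝ≥0∞} (h : ∀ a, f a ≤ g a) :
    P.expect f ≤ P.expect g :=
  P.expect_mono_of_support fun a _ => h a

end PMF

/-! ### Mean return times of Markov chains on ℕ -/

namespace BFCTL

open Filter Topology

variable {K : ℕ → PMF ℕ} {C : Finset ℕ}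

theorem tsum_survival_add_succ (n x : ℕ) :
    ∑' k, survival K C (k + (n + 1)) x
      = (K x).expect fun y => if y ∈ C then 0 else ∑' k, survival K C (k + n) y := by
  simp only [survival, PMF.expect]
  rw [ENNReal.tsum_comm]
  refine tsum_congr fun y => ?_
  rw [ENNReal.tsum_mul_left]
  split_ifs <;> simp

theorem sum_survival_succ (n x : ℕ) :
    ∑ k ∈ Finset.range (n + 1), survival K C k x
      = 1 + (K x).expect fun y => if y ∈ C then 0 else ∑ k ∈ Finset.range n, survival K C k y := by
  rw [Finset.sum_range_succ', add_comm]
  congr 1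
  simp only [survival, PMF.expect]
  rw [← Summable.tsum_finsetSum fun _ _ => ENNReal.summable]
  refine tsum_congr fun y => ?_
  rw [← Finset.mul_sum]
  split_ifs <;> simp

/-- Foster's criterion with a linear Lyapunov function. -/
theorem meanReturnTime_lt_top_of_drift {ε : ℝ≥0∞} (hε : ε ≠ 0)
    (hfin : ∀ x, (K x).expect (fun y => (y : ℝ≥0∞)) ≠ ∞)
    (hdrift : ∀ x ∉ C, (K x).expect (fun y => (y : ℝ≥0∞)) + ε ≤ x) (x : ℕ) :
    meanReturnTime K C x < ∞ := by
  -- An infinite `ε` rules out any state outside `C`, so the return time is 1. The final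
  -- contradiction needs `ε` finite.
  by_cases hε' : ε = ∞
  · have hC : ∀ y, y ∈ C := fun y => by
      by_contra hy
      have := hdrift y hy
      simp [hε'] at this
    rw [meanReturnTime, ENNReal.tsum_eq_iSup_nat]
    refine lt_of_le_of_lt (iSup_le fun n => ?_) (ENNReal.one_lt_top)
    cases n with
    | zero => simp
    | succ n => simp [sum_survival_succ, hC, PMF.expect_const]
  have key : ∀ n, ∀ x ∉ C, ε * ∑ k ∈ Finset.range n, survival K C k x ≤ x := by
    intro n
    induction n with
    | zero => simp
    | succ n ih =>
      intro x hx
      rw [sum_survival_succ, mul_add, mul_one, add_comm]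
      refine le_trans (add_le_add_left ?_ ε) (hdrift x hx)
      rw [PMF.expect, ← ENNReal.tsum_mul_left, PMF.expect]
      refine ENNReal.tsum_le_tsum fun y => ?_
      rw [mul_left_comm]
      refine mul_le_mul_right ?_ _
      split_ifs with hy
      · simp
      · exact ih y hy
  -- The drift is known only outside `C`; one first step extends the estimate to every starting
  -- point.
  have bound : ε * meanReturnTime K C x ≤ ε + (K x).expect (fun y => (y : ℝ≥0∞)) := by
    rw [meanReturnTime, ENNReal.tsum_eq_iSup_nat, ENNReal.mul_iSup]
    refine iSup_le fun n => ?_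
    refine le_trans (mul_le_mul_right (Finset.sum_le_sum_of_subset
      (Finset.range_mono n.le_succ)) _) ?_
    rw [sum_survival_succ, mul_add, mul_one]
    refine add_le_add_right ?_ ε
    rw [PMF.expect, ← ENNReal.tsum_mul_left, PMF.expect]
    refine ENNReal.tsum_le_tsum fun y => ?_
    rw [mul_left_comm]
    refine mul_le_mul_right ?_ _
    split_ifs with hy
    · simp
    · exact key n y hy
  by_contra htop
  rw [not_lt, top_le_iff] at htop
  rw [htop, ENNReal.mul_top hε, top_le_iff] at bound
  exact ENNReal.add_ne_top.2 ⟨hε', hfin x⟩ bound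

/-- A chain with nonnegative drift and bounded downward jumps is not positive recurrent. -/
theorem exists_meanReturnTime_eq_top (K : ℕ → PMF ℕ) (C : Finset ℕ) {M : ℕ} (N : ℕ)
    (hM : 0 < M) (hjump : ∀ x, ∀ y ∈ (K x).support, x ≤ y + M)
    (hdrift : ∀ x, N ≤ x → (x : ℝ≥0∞) ≤ (K x).expect fun y => (y : ℝ≥0∞)) :
    ∃ x, meanReturnTime K C x = ∞ := by
  obtain ⟨A, hNA, hCA⟩ : ∃ A, N ≤ A ∧ ∀ y ∈ C, y ≤ A :=
    ⟨max N (C.sup id), le_max_left _ _, fun y hy =>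
      le_trans (Finset.le_sup (f := id) hy) (le_max_right _ _)⟩
  -- `C` lies in `[0, A]` and each step descends by at most `M`, so reaching `C` takes at least `(x
  -- - A) / M` steps; this is the version truncated at time `n`.
  have partial_le : ∀ n x : ℕ, ((min (x - A) (n * M) : ℕ) : ℝ≥0∞)
      ≤ M * ∑ k ∈ Finset.range n, survival K C k x := by
    intro n
    induction n with
    | zero => simp
    | succ n ih =>
      intro x
      have h1 : ((min (x - A - M) (n * M) : ℕ) : ℝ≥0∞) ≤ M * (K x).expect fun y =>
          if y ∈ C then 0 else ∑ k ∈ Finset.range n, survival K C k y := by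
        rw [← PMF.expect_const (K x) ((min (x - A - M) (n * M) : ℕ) : ℝ≥0∞)]
        rw [PMF.expect, PMF.expect, ← ENNReal.tsum_mul_left]
        refine (PMF.expect_mono_of_support (K x) (g := fun y =>
          M * if y ∈ C then 0 else ∑ k ∈ Finset.range n, survival K C k y) ?_).trans_eq ?_
        · intro y hy
          have hxy := hjump x y hy
          split_ifs with hyC
          · have := hCA y hyC
            have h0 : x - A - M = 0 := by omega
            simp [h0]
          · refine le_trans ?_ (ih y)
            exact_mod_cast min_le_min_right _ (by omega)
        · simp only [PMF.expect, mul_left_comm]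
      rw [sum_survival_succ, mul_add, mul_one]
      refine le_trans ?_ (add_le_add_right h1 _)
      have : min (x - A) ((n + 1) * M) ≤ M + min (x - A - M) (n * M) := by
        rw [add_mul, one_mul]
        omega
      exact_mod_cast this
  -- The same lower bound survives deletion of the first `n` terms: above `A` the mean of the next
  -- state is at least `x`, and states in `C` contribute at most `A` to it.
  have tail_ge : ∀ n x : ℕ, ((x - A : ℕ) : ℝ≥0∞) ≤ M * ∑' k, survival K C (k + n) x := by
    intro n
    induction n with
    | zero =>
      intro x
      refine le_trans ?_ (le_trans (partial_le x x)
        (mul_le_mul_right (ENNReal.sum_le_tsum _) _))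
      have : x - A ≤ min (x - A) (x * M) := by
        have : x * 1 ≤ x * M := Nat.mul_le_mul_left x hM
        omega
      exact_mod_cast this
    | succ n ih =>
      intro x
      rw [tsum_survival_add_succ]
      rcases le_total x A with hx | hx
      · simp [Nat.sub_eq_zero_of_le hx]
      have h1 : (K x).expect (fun y => (y : ℝ≥0∞)) ≤
          A + M * (K x).expect fun y => if y ∈ C then 0 else ∑' k, survival K C (k + n) y := by
        have : (M : ℝ≥0∞) * (K x).expect (fun y => if y ∈ C then 0 else
            ∑' k, survival K C (k + n) y) = (K x).expect fun y => M * if y ∈ C then 0 else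
            ∑' k, survival K C (k + n) y := by
          simp only [PMF.expect, ← ENNReal.tsum_mul_left, mul_left_comm]
        rw [this, ← PMF.expect_const (K x) (A : ℝ≥0∞), ← PMF.expect_add]
        refine PMF.expect_mono _ fun y => ?_
        split_ifs with hyC
        · simpa using hCA y hyC
        · refine le_trans ?_ (add_le_add_right (ih y) _)
          have : y ≤ A + (y - A) := by omega
          exact_mod_cast this
      have h2 := (hdrift x (hNA.trans hx)).trans h1
      rw [ENNReal.natCast_sub]
      exact tsub_le_iff_left.2 h2
  -- The tails of a convergent series tend to 0, but from `A + 1` they stay at least `1 / M`.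
  refine ⟨A + 1, by_contra fun hne => ?_⟩
  have hlim := ENNReal.Tendsto.const_mul (a := (M : ℝ≥0∞))
    (ENNReal.tendsto_sum_nat_add (fun k => survival K C k (A + 1)) hne)
    (Or.inr (ENNReal.natCast_ne_top M))
  have := ge_of_tendsto' hlim fun n => tail_ge n (A + 1)
  simp at this

/-! ### Stationary distributions from drift -/

/-- The law after `n` steps of the chain started in `0`. -/
noncomputable def stepLaw (K : ℕ → PMF ℕ) : ℕ → PMF ℕ
  | 0 => PMF.pure 0
  | n + 1 => (stepLaw K n).bind K

/-- Averages of the laws of the first `n + 1` steps of the chain started in `0`. -/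
noncomputable def cesaro (K : ℕ → PMF ℕ) (n x : ℕ) : ℝ≥0∞ :=
  (∑ k ∈ Finset.range (n + 1), stepLaw K k x) * ((n + 1 : ℕ) : ℝ≥0∞)⁻¹

theorem tsum_cesaro (K : ℕ → PMF ℕ) (n : ℕ) : ∑' x, cesaro K n x = 1 := by
  simp only [cesaro]
  rw [ENNReal.tsum_mul_right, Summable.tsum_finsetSum fun _ _ => ENNReal.summable]
  simp only [PMF.tsum_coe, Finset.sum_const, Finset.card_range, nsmul_eq_mul, mul_one]
  exact ENNReal.mul_inv_cancel (by simp) (ENNReal.natCast_ne_top _)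

/-- One step of the chain shifts the averaging window by one; the only new term is a probability,
hence at most 1. -/
theorem tsum_cesaro_mul_le (K : ℕ → PMF ℕ) (n x : ℕ) :
    ∑' y, cesaro K n y * K y x ≤ cesaro K n x + ((n + 1 : ℕ) : ℝ≥0∞)⁻¹ := by
  have h : ∑' y, cesaro K n y * K y x
      = (∑ k ∈ Finset.range (n + 1), stepLaw K (k + 1) x) * ((n + 1 : ℕ) : ℝ≥0∞)⁻¹ := by
    simp only [cesaro, stepLaw, PMF.bind_apply]
    rw [← Summable.tsum_finsetSum fun _ _ => ENNReal.summable, ← ENNReal.tsum_mul_right]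
    refine tsum_congr fun y => ?_
    rw [mul_right_comm, Finset.sum_mul]
  rw [h, cesaro, ← add_one_mul]
  refine mul_le_mul_left ?_ _
  have h2 : ∑ k ∈ Finset.range (n + 1), stepLaw K (k + 1) x
      ≤ ∑ k ∈ Finset.range (n + 2), stepLaw K k x := by
    rw [Finset.sum_range_succ' _ (n + 1)]
    exact le_self_add
  refine h2.trans ?_
  rw [Finset.sum_range_succ _ (n + 1)]
  exact add_le_add_right (PMF.coe_le_one _ _) _

/-- Telescoping the drift from the state 0, whose initial mean is 0, bounds `n * ε` by `B` times the
expected time spent in `C`. The bound is uniform in `n`, so the mass on `C` cannot escape to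
infinity. -/
theorem le_mul_sum_cesaro {ε B : ℝ≥0∞}
    (hdrift : ∀ x, (K x).expect (fun y => (y : ℝ≥0∞)) + ε ≤ x + if x ∈ C then B else 0) (n : ℕ) :
    ε ≤ B * ∑ x ∈ C, cesaro K n x := by
  have hind : ∀ P : PMF ℕ, (P.expect fun x => if x ∈ C then B else 0) = B * ∑ x ∈ C, P x := by
    intro P
    rw [PMF.expect, tsum_eq_sum (s := C) (fun x hx => by simp [hx]), Finset.mul_sum]
    exact Finset.sum_congr rfl fun x hx => by simp [hx, mul_comm]
  have hn : ∀ n : ℕ, (stepLaw K n).expect (fun y => (y : ℝ≥0∞)) + n * ε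
      ≤ B * ∑ x ∈ C, ∑ k ∈ Finset.range n, stepLaw K k x := by
    intro n
    induction n with
    | zero => simp [stepLaw, PMF.expect_pure]
    | succ n ih =>
      have h1 := PMF.expect_mono (stepLaw K n) hdrift
      rw [PMF.expect_add, PMF.expect_add, PMF.expect_const, ← PMF.expect_bind, hind] at h1
      simp only [Finset.sum_range_succ, Finset.sum_add_distrib, mul_add]
      calc (stepLaw K (n + 1)).expect (fun y => (y : ℝ≥0∞)) + ((n + 1 : ℕ) : ℝ≥0∞) * ε
          = ((stepLaw K (n + 1)).expect (fun y => (y : ℝ≥0∞)) + ε) + n * ε := by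
            push_cast; ring
        _ ≤ _ := add_le_add_left h1 _
        _ = ((stepLaw K n).expect (fun y => (y : ℝ≥0∞)) + n * ε)
            + B * ∑ x ∈ C, stepLaw K n x := by ring
        _ ≤ _ := add_le_add_left ih _
  have h2 := le_trans le_add_self (hn (n + 1))
  simp only [cesaro, ← Finset.sum_mul]
  rw [← mul_assoc, ← div_eq_mul_inv, ENNReal.le_div_iff_mul_le (by simp) (by simp), mul_comm]
  exact h2

/-- Krylov–Bogoliubov: compactness of `ℝ≥0∞` gives pointwise limits of the averages along an
ultrafilter. The limit is nonzero because of its mass on `C`, and can be normalized. -/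
theorem exists_stationary_of_drift (K : ℕ → PMF ℕ) (C : Finset ℕ) {ε B : ℝ≥0∞} (hε : ε ≠ 0)
    (hB : B ≠ ∞)
    (hdrift : ∀ x, (K x).expect (fun y => (y : ℝ≥0∞)) + ε ≤ x + if x ∈ C then B else 0) :
    ∃ π : PMF ℕ, π.bind K = π := by
  have hlim : ∀ x, ∃ l, Tendsto (fun n => cesaro K n x) (hyperfilter ℕ : Filter ℕ) (𝓝 l) :=
    fun x => ⟨_, ((hyperfilter ℕ).map fun n => cesaro K n x).le_nhds_lim⟩
  choose μ hμ using hlim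
  have hU : (hyperfilter ℕ : Filter ℕ) ≤ atTop := Nat.hyperfilter_le_atTop
  have hmass : ∑' x, μ x ≤ 1 := by
    rw [ENNReal.tsum_eq_iSup_sum]
    refine iSup_le fun F => ?_
    refine le_of_tendsto' (tendsto_finsetSum F fun x _ => hμ x) fun n => ?_
    exact (ENNReal.sum_le_tsum F).trans_eq (tsum_cesaro K n)
  have hne : ∑' x, μ x ≠ ∞ := ne_top_of_le_ne_top ENNReal.one_ne_top hmass
  have hpos : ∑' x, μ x ≠ 0 := by
    intro h0
    have hz := ENNReal.tsum_eq_zero.1 h0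
    have := ge_of_tendsto' (ENNReal.Tendsto.const_mul (tendsto_finsetSum C fun x _ => hμ x)
      (Or.inr hB)) fun n => le_mul_sum_cesaro hdrift n
    simp [hz] at this
    exact hε this
  -- Only finite partial sums pass to the limit, so at first only subinvariance is obtained.
  have hsub : ∀ x, ∑' y, μ y * K y x ≤ μ x := by
    intro x
    rw [ENNReal.tsum_eq_iSup_sum]
    refine iSup_le fun F => ?_
    have h0 : Tendsto (fun n : ℕ => ((n + 1 : ℕ) : ℝ≥0∞)⁻¹) (hyperfilter ℕ : Filter ℕ) (𝓝 0) :=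
      ((tendsto_add_atTop_iff_nat 1).2 ENNReal.tendsto_inv_nat_nhds_zero).mono_left hU
    have h1 := (hμ x).add h0
    rw [add_zero] at h1
    refine le_of_tendsto_of_tendsto' (tendsto_finsetSum F fun y _ =>
      ENNReal.Tendsto.mul_const (hμ y) (Or.inr (PMF.apply_ne_top _ _))) h1 fun n => ?_
    exact (ENNReal.sum_le_tsum F).trans (tsum_cesaro_mul_le K n x)
  have htot : ∑' x, ∑' y, μ y * K y x = ∑' x, μ x := by
    rw [ENNReal.tsum_comm]
    simp only [ENNReal.tsum_mul_left, PMF.tsum_coe, mul_one]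
  -- Both sides have the same finite total mass, so no pointwise inequality can be strict.
  have hinv : ∀ x, ∑' y, μ y * K y x = μ x := by
    intro x
    by_contra hx
    exact (ENNReal.tsum_lt_tsum (htot ▸ hne) hsub (lt_of_le_of_ne (hsub x) hx)).ne htot
  refine ⟨PMF.normalize μ hpos hne, PMF.ext fun x => ?_⟩
  rw [PMF.bind_apply]
  simp only [PMF.normalize_apply, mul_right_comm _ _ (K _ x)]
  rw [ENNReal.tsum_mul_right, hinv]

end BFCTL
-- The law of a single slot
namespace BFCTL

theorem expect_coin (p : unitInterval) (f : Bool → ℝ≥0∞) :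
    (coin p).expect f = ENNReal.ofReal p * f true + ENNReal.ofReal (1 - p) * f false := by
  simp [PMF.expect, tsum_fintype, coin]

variable (Q : BFCTL)

theorem expect_slotLaw (i : ℕ) (s : ℕ × Bool) (f : (ℕ × Bool) × ℕ → ℝ≥0∞) :
    (Q.slotLaw i s).expect f = (Q.arr i).expect fun a => (coin (Q.p i)).expect fun turn =>
      (coin (Q.q i)).expect fun ped => f (Q.update i s a.1 a.2 turn ped) := by
  simp only [slotLaw, PMF.expect_bind, PMF.expect_map]

theorem exists_update_of_mem_support_slotLaw {i : ℕ} {s : ℕ × Bool} {w : (ℕ × Bool) × ℕ}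
    (hw : w ∈ (Q.slotLaw i s).support) :
    ∃ y yb turn ped, yb ≤ y ∧ w = Q.update i s y yb turn ped := by
  simp only [slotLaw, PMF.mem_support_bind_iff, PMF.mem_support_map_iff] at hw
  obtain ⟨a, ha, turn, -, ped, -, rfl⟩ := hw
  exact ⟨a.1, a.2, turn, ped, Q.arr_le i a ha, rfl⟩

/-! ### Expectations along a cycle -/

theorem expect_run_succ (s : ℕ × Bool) (i : ℕ) (f : ℕ × Bool → ℝ≥0∞) :
    ((Q.run s (i + 1)).expect fun z => (z.2 : ℝ≥0∞) + f z.1)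
      = (Q.run s i).expect fun z => z.2 +
          (Q.slotLaw (i + 1) z.1).expect fun w => (w.2 : ℝ≥0∞) + f w.1 := by
  simp only [run, PMF.expect_bind, PMF.expect_map]
  congr 1
  funext z
  simp only [Nat.cast_add, add_assoc]
  rw [PMF.expect_add, PMF.expect_const]

/-- Supermartingale principle: if the reward of a slot plus the next potential never exceeds the
current one in mean, the initial potential bounds the whole run. -/
theorem expect_run_le (φ : ℕ → ℕ × Bool → ℝ≥0∞) (n : ℕ)
    (hφ : ∀ i < n, ∀ s,
      ((Q.slotLaw (i + 1) s).expect fun w => (w.2 : ℝ≥0∞) + φ (i + 1) w.1) ≤ φ i s)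
    (s : ℕ × Bool) : ((Q.run s n).expect fun z => (z.2 : ℝ≥0∞) + φ n z.1) ≤ φ 0 s := by
  induction n with
  | zero => simp [run, PMF.expect_pure]
  | succ n ih =>
    rw [expect_run_succ]
    refine (PMF.expect_mono _ fun z => ?_).trans (ih fun i hi => hφ i (by omega))
    exact add_le_add_right (hφ n (by omega) z.1) _

theorem expect_run_eq (φ : ℕ → ℕ × Bool → ℝ≥0∞) (n : ℕ) (s : ℕ × Bool)
    (hφ : ∀ i < n, ∀ z ∈ (Q.run s i).support,
      ((Q.slotLaw (i + 1) z.1).expect fun w => (w.2 : ℝ≥0∞) + φ (i + 1) w.1) = φ i z.1) :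
    ((Q.run s n).expect fun z => (z.2 : ℝ≥0∞) + φ n z.1) = φ 0 s := by
  induction n with
  | zero => simp [run, PMF.expect_pure]
  | succ n ih =>
    rw [expect_run_succ, ← ih fun i hi => hφ i (by omega)]
    exact PMF.expect_congr_of_support _ fun z hz => by rw [hφ n (by omega) z hz]

theorem le_fst_add_of_mem_support_run (s : ℕ × Bool) (i : ℕ) :
    ∀ z ∈ (Q.run s i).support, s.1 ≤ z.1.1 + Q.m * min i (Q.g1 + Q.g2) := by
  induction i with
  | zero =>
    intro z hz
    simp only [run, PMF.mem_support_pure_iff] at hz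
    simp [hz]
  | succ i ih =>
    intro z hz
    simp only [run, PMF.mem_support_bind_iff, PMF.mem_support_map_iff] at hz
    obtain ⟨z', hz', w, hw, rfl⟩ := hz
    obtain ⟨y, yb, turn, ped, -, rfl⟩ := Q.exists_update_of_mem_support_slotLaw hw
    have h1 := ih z' hz'
    rcases le_or_gt (i + 1) (Q.g1 + Q.g2) with hi | hi
    · rw [min_eq_left (by omega)] at h1
      rw [min_eq_left hi, mul_add, mul_one]
      simp only [update, serve]
      split_ifs <;> simp only <;> omega
    · rw [min_eq_right (by omega)] at h1 ⊢
      have h2 : ¬ i + 1 ≤ Q.g1 := by omega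
      simp only [update, if_neg h2, if_neg hi.not_ge]
      omega

/-- Vehicles can be lost from this count only when arrivals pass through undelayed, which happens
when fewer than `m` vehicles are waiting. -/
theorem update_fst_add_le {i : ℕ} {s : ℕ × Bool} {y yb : ℕ} {turn ped : Bool} (h : yb ≤ y) :
    (Q.update i s y yb turn ped).2 + (Q.update i s y yb turn ped).1.1 ≤ s.1 + y := by
  simp only [update, serve]
  split_ifs <;> simp only <;> omega

theorem update_fst_add_eq {i : ℕ} {s : ℕ × Bool} (y yb : ℕ) (turn ped : Bool)
    (h : i ≤ Q.g1 + Q.g2 → Q.m ≤ s.1) :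
    (Q.update i s y yb turn ped).2 + (Q.update i s y yb turn ped).1.1 = s.1 + y := by
  have := Q.m_pos
  simp only [update, serve]
  split_ifs <;> simp only <;> omega

theorem m_le_of_mem_support_run {s : ℕ × Bool} (hs : Q.m * (Q.g1 + Q.g2) ≤ s.1) {i : ℕ}
    {z : (ℕ × Bool) × ℕ} (hz : z ∈ (Q.run s i).support) (hi : i < Q.g1 + Q.g2) : Q.m ≤ z.1.1 := by
  have h1 := hs.trans (Q.le_fst_add_of_mem_support_run s i z hz)
  rw [min_eq_left hi.le] at h1
  have h2 := Nat.mul_le_mul_left Q.m (Nat.succ_le_of_lt hi)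
  rw [Nat.mul_succ] at h2
  omega

theorem expect_arr_fst (i : ℕ) :
    ((Q.arr i).expect fun a => (a.1 : ℝ≥0∞)) = Q.meanArrivals i := rfl

/-- Delayed vehicles plus the mean number of arrivals that are still to come in the cycle. -/
noncomputable def futureLoad (i : ℕ) (s : ℕ × Bool) : ℝ≥0∞ :=
  s.1 + ∑ j ∈ Finset.Ioc i Q.c, Q.meanArrivals j

theorem sum_meanArrivals_Ioc {i : ℕ} (hi : i < Q.c) :
    ∑ j ∈ Finset.Ioc i Q.c, Q.meanArrivals j
      = Q.meanArrivals (i + 1) + ∑ j ∈ Finset.Ioc (i + 1) Q.c, Q.meanArrivals j := by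
  rw [← Finset.insert_Ioc_add_one_left_eq_Ioc hi, Finset.sum_insert (by simp)]

theorem expect_slotLaw_futureLoad {i : ℕ} (s : ℕ × Bool) :
    ((Q.slotLaw (i + 1) s).expect fun w => (w.2 : ℝ≥0∞) + Q.futureLoad (i + 1) w.1)
      = (Q.slotLaw (i + 1) s).expect (fun w => ((w.2 + w.1.1 : ℕ) : ℝ≥0∞))
        + ∑ j ∈ Finset.Ioc (i + 1) Q.c, Q.meanArrivals j := by
  simp only [futureLoad, ← add_assoc]
  rw [PMF.expect_add, PMF.expect_const]
  simp only [Nat.cast_add]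

theorem expect_slotLaw_futureLoad_le {i : ℕ} (hi : i < Q.c) (s : ℕ × Bool) :
    ((Q.slotLaw (i + 1) s).expect fun w => (w.2 : ℝ≥0∞) + Q.futureLoad (i + 1) w.1)
      ≤ Q.futureLoad i s := by
  rw [expect_slotLaw_futureLoad, futureLoad, Q.sum_meanArrivals_Ioc hi, ← add_assoc]
  refine add_le_add_left ?_ _
  rw [expect_slotLaw]
  refine (PMF.expect_mono_of_support _ (g := fun a => (s.1 : ℝ≥0∞) + a.1) fun a ha => ?_).trans_eq
    (by rw [PMF.expect_add, PMF.expect_const, expect_arr_fst])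
  rw [← PMF.expect_const (coin (Q.p (i + 1))) ((s.1 : ℝ≥0∞) + a.1)]
  refine PMF.expect_mono _ fun turn => ?_
  rw [← PMF.expect_const (coin (Q.q (i + 1))) ((s.1 : ℝ≥0∞) + a.1)]
  refine PMF.expect_mono _ fun ped => ?_
  exact_mod_cast Q.update_fst_add_le (Q.arr_le _ a ha)

theorem expect_slotLaw_futureLoad_eq {i : ℕ} (hi : i < Q.c) (s : ℕ × Bool)
    (h : i + 1 ≤ Q.g1 + Q.g2 → Q.m ≤ s.1) :
    ((Q.slotLaw (i + 1) s).expect fun w => (w.2 : ℝ≥0∞) + Q.futureLoad (i + 1) w.1)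
      = Q.futureLoad i s := by
  rw [expect_slotLaw_futureLoad, futureLoad, Q.sum_meanArrivals_Ioc hi, ← add_assoc]
  congr 1
  simp only [expect_slotLaw, Q.update_fst_add_eq _ _ _ _ h, PMF.expect_const]
  simp only [Nat.cast_add]
  rw [PMF.expect_add, PMF.expect_const, expect_arr_fst]

theorem meanDepartures_add_expect_cycleKernel (x : ℕ) :
    Q.meanDepartures x + (Q.cycleKernel x).expect (fun y => (y : ℝ≥0∞))
      = (Q.run (x, false) Q.c).expect fun z => (z.2 : ℝ≥0∞) + Q.futureLoad Q.c z.1 := by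
  rw [cycleKernel, PMF.expect_map, PMF.expect_add]
  simp only [futureLoad, Finset.Ioc_self, Finset.sum_empty, add_zero]
  rfl

theorem meanDepartures_add_expect_cycleKernel_le (x : ℕ) :
    Q.meanDepartures x + (Q.cycleKernel x).expect (fun y => (y : ℝ≥0∞))
      ≤ x + ∑ i ∈ Finset.Icc 1 Q.c, Q.meanArrivals i := by
  rw [meanDepartures_add_expect_cycleKernel]
  exact Q.expect_run_le Q.futureLoad Q.c (fun i hi s => Q.expect_slotLaw_futureLoad_le hi s) _

/-- Vehicles are conserved in a cycle that starts with a long queue. -/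
theorem meanDepartures_add_expect_cycleKernel_eq {x : ℕ} (hx : Q.m * (Q.g1 + Q.g2) ≤ x) :
    Q.meanDepartures x + (Q.cycleKernel x).expect (fun y => (y : ℝ≥0∞))
      = x + ∑ i ∈ Finset.Icc 1 Q.c, Q.meanArrivals i := by
  rw [meanDepartures_add_expect_cycleKernel]
  exact Q.expect_run_eq Q.futureLoad Q.c (x, false) fun i hi z hz =>
    Q.expect_slotLaw_futureLoad_eq hi z.1 fun h => Q.m_le_of_mem_support_run hx hz h

theorem le_add_of_mem_support_cycleKernel {x y : ℕ} (hy : y ∈ (Q.cycleKernel x).support) :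
    x ≤ y + Q.m * (Q.g1 + Q.g2) := by
  simp only [cycleKernel, PMF.mem_support_map_iff] at hy
  obtain ⟨z, hz, rfl⟩ := hy
  refine (Q.le_fst_add_of_mem_support_run (x, false) Q.c z hz).trans ?_
  exact Nat.add_le_add_left (Nat.mul_le_mul_left _ (min_le_right _ _)) _

/-! ### The mean number of departures -/

/-- Mean reward still to be collected after slot `i`, not counting that of slot `i`. -/
noncomputable def toGo (blocked : Bool) (i : ℕ) : ℝ :=
  if i ≤ Q.g1 then Q.earlyReward blocked i - (if blocked = true then 0 else (Q.m : ℝ))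
  else Q.lateReward (i + 1)

theorem toGo_of_le {i : ℕ} (hi : Q.g1 ≤ i) (b : Bool) : Q.toGo b i = Q.lateReward (i + 1) := by
  rcases hi.eq_or_lt with rfl | hi
  · cases b <;> simp [toGo, earlyReward]
  · simp [toGo, hi]

theorem toGo_true {i : ℕ} (hi : i < Q.g1) :
    Q.toGo true i = Q.q (i + 1) * Q.toGo true (i + 1)
      + (1 - Q.q (i + 1)) * (Q.m + Q.toGo false (i + 1)) := by
  have h : i + 1 ≤ Q.g1 := hi
  simp only [toGo, hi.le, h, if_true]
  rw [earlyReward]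
  simp [hi]

theorem toGo_false {i : ℕ} (hi : i < Q.g1) :
    Q.toGo false i = Q.p (i + 1) * Q.q (i + 1) * Q.toGo true (i + 1)
      + (1 - Q.p (i + 1) * Q.q (i + 1)) * (Q.m + Q.toGo false (i + 1)) := by
  have h : i + 1 ≤ Q.g1 := hi
  simp only [toGo, hi.le, h, if_true]
  rw [earlyReward]
  simp only [hi, if_true, Bool.false_eq_true, if_false]
  ring

theorem toGo_late {i : ℕ} (hi : Q.g1 ≤ i) (hc : i < Q.c) (b b' : Bool) :
    Q.toGo b i = (if i + 1 ≤ Q.g1 + Q.g2 then (Q.m : ℝ) else 0) + Q.toGo b' (i + 1) := by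
  rw [toGo_of_le Q hi, toGo_of_le Q (by omega), lateReward, if_neg (by omega)]

theorem toGo_c (b : Bool) : Q.toGo b Q.c = 0 := by
  rw [toGo_of_le Q (by unfold c; omega), lateReward, if_pos (by omega)]

/-- For `0 < g1`, index 0 acts as a fictitious unblocked slot: unfolding `earlyReward` there adds a
reward `m`, which `toGo` removes. -/
theorem r0_eq_toGo : Q.r0 = Q.toGo false 0 := by
  rw [r0]
  split_ifs with h
  · rw [toGo_of_le Q h.le]
  · rw [toGo_false Q (by omega)]
    simp [toGo, show 1 ≤ Q.g1 by omega]

/-- A blocked queue is obstructed with probability `q`, an unblocked one only with `p * q`, and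
obstruction forfeits `m` and leads to the worse state. -/
theorem toGo_bounds {i : ℕ} (hi : i ≤ Q.c) :
    0 ≤ Q.toGo true i ∧ Q.toGo true i ≤ Q.toGo false i := by
  induction hi using Nat.decreasingInduction with
  | self => simp [toGo_c]
  | @of_succ i hi ih =>
    rcases lt_or_ge i Q.g1 with h | h
    · rw [toGo_true Q h, toGo_false Q h]
      have hq0 := (Q.q (i + 1)).2.1
      have hq1 := (Q.q (i + 1)).2.2
      have hp1 := (Q.p (i + 1)).2.2
      have hm : (0 : ℝ) ≤ Q.m := Nat.cast_nonneg _
      constructor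
      · have := ih.1.trans ih.2
        have := ih.1
        have := sub_nonneg.2 hq1
        positivity
      · nlinarith [mul_nonneg (mul_nonneg hq0 (sub_nonneg.2 hp1))
          (add_nonneg hm (sub_nonneg.2 ih.2))]
    · rw [toGo_late Q h hi true true, toGo_late Q h hi false true]
      have hm : (0 : ℝ) ≤ Q.m := Nat.cast_nonneg _
      refine ⟨?_, le_rfl⟩
      split_ifs <;> linarith [ih.1]

theorem toGo_nonneg {i : ℕ} (hi : i ≤ Q.c) (b : Bool) : 0 ≤ Q.toGo b i := by
  have := Q.toGo_bounds hi
  cases b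
  · linarith
  · exact this.1

theorem toGo_true_succ_le {i : ℕ} (hi : i < Q.g1) : Q.toGo true (i + 1) ≤ Q.toGo true i := by
  rw [toGo_true Q hi]
  have h1 := (Q.toGo_bounds (i := i + 1) (by unfold c; omega)).2
  have hm : (0 : ℝ) ≤ Q.m := Nat.cast_nonneg _
  nlinarith [mul_nonneg (sub_nonneg.2 (Q.q (i + 1)).2.2) (add_nonneg hm (sub_nonneg.2 h1))]

theorem expect_coins_reward {i : ℕ} (hi : i < Q.g1) (b : Bool) :
    ((coin (Q.p (i + 1))).expect fun turn => (coin (Q.q (i + 1))).expect fun ped =>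
      if ped = true ∧ (b = true ∨ turn = true) then ENNReal.ofReal (Q.toGo true (i + 1))
      else Q.m + ENNReal.ofReal (Q.toGo false (i + 1))) = ENNReal.ofReal (Q.toGo b i) := by
  have hc : i + 1 ≤ Q.c := by unfold c; omega
  have hA := Q.toGo_nonneg hc true
  have hB : 0 ≤ (Q.m : ℝ) + Q.toGo false (i + 1) :=
    add_nonneg (Nat.cast_nonneg _) (Q.toGo_nonneg hc false)
  have hp0 := (Q.p (i + 1)).2.1
  have hp1 := sub_nonneg.2 (Q.p (i + 1)).2.2
  have hq0 := (Q.q (i + 1)).2.1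
  have hq1 := sub_nonneg.2 (Q.q (i + 1)).2.2
  rw [← ENNReal.ofReal_natCast Q.m,
    ← ENNReal.ofReal_add (Nat.cast_nonneg _) (Q.toGo_nonneg hc false)]
  cases b
  · simp only [expect_coin, Bool.false_eq_true, false_or, and_true, and_false, if_true, if_false,
      ← ENNReal.ofReal_mul hq0, ← ENNReal.ofReal_mul hq1, ← ENNReal.ofReal_mul hp0,
      ← ENNReal.ofReal_mul hp1,
      ← ENNReal.ofReal_add (mul_nonneg hq0 hA) (mul_nonneg hq1 hB),
      ← ENNReal.ofReal_add (mul_nonneg hq0 hB) (mul_nonneg hq1 hB)]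
    rw [← ENNReal.ofReal_add (by positivity) (by positivity), toGo_false Q hi]
    congr 1
    ring
  · simp only [expect_coin, Bool.false_eq_true, true_or, and_true, if_true, if_false,
      ← ENNReal.ofReal_mul hq0, ← ENNReal.ofReal_mul hq1, ← ENNReal.ofReal_mul hp0,
      ← ENNReal.ofReal_mul hp1,
      ← ENNReal.ofReal_add (mul_nonneg hq0 hA) (mul_nonneg hq1 hB)]
    rw [← ENNReal.ofReal_add (by positivity) (by positivity), toGo_true Q hi]
    congr 1
    ring

theorem ofReal_toGo_late {i : ℕ} (hi : Q.g1 ≤ i) (hc : i < Q.c) (b b' : Bool) :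
    ENNReal.ofReal (Q.toGo b i)
      = (if i + 1 ≤ Q.g1 + Q.g2 then (Q.m : ℝ≥0∞) else 0)
        + ENNReal.ofReal (Q.toGo b' (i + 1)) := by
  rw [toGo_late Q hi hc b b', ENNReal.ofReal_add (by split_ifs <;> simp) (Q.toGo_nonneg hc b')]
  split_ifs <;> simp

/-- An empty queue must be valued as blocked. With its own flag the inequality can fail: an empty
unblocked queue may stay so, while the recursion charges it for a possible turning batch. Valued as
blocked, it earns nothing and its potential does not increase (`toGo_true_succ_le`). -/
theorem expect_slotLaw_toGo_le {i : ℕ} (hc : i < Q.c) (s : ℕ × Bool) :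
    ((Q.slotLaw (i + 1) s).expect fun w =>
        (w.2 : ℝ≥0∞) + ENNReal.ofReal (Q.toGo (w.1.2 || decide (w.1.1 = 0)) (i + 1)))
      ≤ ENNReal.ofReal (Q.toGo (s.2 || decide (s.1 = 0)) i) := by
  rw [expect_slotLaw, ← PMF.expect_const (Q.arr (i + 1)) (ENNReal.ofReal _)]
  refine PMF.expect_mono _ fun a => ?_
  rcases lt_or_ge i Q.g1 with hi | hi
  · by_cases hx : s.1 = 0
    · rw [← PMF.expect_const (coin (Q.p (i + 1))) (ENNReal.ofReal _)]
      refine PMF.expect_mono _ fun turn => ?_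
      rw [← PMF.expect_const (coin (Q.q (i + 1))) (ENNReal.ofReal _)]
      refine PMF.expect_mono _ fun ped => ?_
      have h1 : i + 1 ≤ Q.g1 := hi
      have h2 := ENNReal.ofReal_le_ofReal (Q.toGo_true_succ_le hi)
      simp only [update, h1, hx, if_true]
      split_ifs <;> simpa using h2
    · rw [← Q.expect_coins_reward hi]
      refine PMF.expect_mono _ fun turn => PMF.expect_mono _ fun ped => ?_
      have h1 : i + 1 ≤ Q.g1 := hi
      simp only [update, h1, hx, if_true, if_false, decide_false, Bool.or_false]
      split_ifs with h
      · simp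
      · simp only [Bool.false_or]
        refine add_le_add (by exact_mod_cast min_le_right _ _) (ENNReal.ofReal_le_ofReal ?_)
        -- If service empties the queue, the potential drops to the blocked value, which is smaller.
        have := Q.toGo_bounds hc
        cases decide (Q.serve s.1 a.1 = 0)
        · exact le_rfl
        · exact this.2
  · rw [← PMF.expect_const (coin (Q.p (i + 1))) (ENNReal.ofReal _)]
    refine PMF.expect_mono _ fun turn => ?_
    rw [← PMF.expect_const (coin (Q.q (i + 1))) (ENNReal.ofReal _)]
    refine PMF.expect_mono _ fun ped => ?_
    have h1 : ¬ i + 1 ≤ Q.g1 := by omega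
    rw [Q.ofReal_toGo_late hi hc _ _]
    refine add_le_add_left ?_ _
    simp only [update, h1, if_false]
    split_ifs
    · exact_mod_cast min_le_right _ _
    · simp

theorem expect_slotLaw_toGo_eq {i : ℕ} (hc : i < Q.c) (s : ℕ × Bool)
    (hs : i + 1 ≤ Q.g1 + Q.g2 → Q.m ≤ s.1) :
    ((Q.slotLaw (i + 1) s).expect fun w =>
        (w.2 : ℝ≥0∞) + ENNReal.ofReal (Q.toGo w.1.2 (i + 1))) = ENNReal.ofReal (Q.toGo s.2 i) := by
  rw [expect_slotLaw, ← PMF.expect_const (Q.arr (i + 1)) (ENNReal.ofReal _)]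
  congr 1
  funext a
  have hm := Q.m_pos
  rcases lt_or_ge i Q.g1 with hi | hi
  · rw [← Q.expect_coins_reward hi]
    congr 1
    funext turn
    congr 1
    funext ped
    have h1 : i + 1 ≤ Q.g1 := hi
    have h2 : Q.m ≤ s.1 := hs (by omega)
    have h3 : s.1 ≠ 0 := by omega
    simp only [update, h1, h3, if_true, if_false, min_eq_right h2]
    split_ifs <;> simp
  · have h1 : ¬ i + 1 ≤ Q.g1 := by omega
    have key : ∀ turn ped, (((Q.update (i + 1) s a.1 a.2 turn ped).2 : ℕ) : ℝ≥0∞)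
        + ENNReal.ofReal (Q.toGo (Q.update (i + 1) s a.1 a.2 turn ped).1.2 (i + 1))
        = ENNReal.ofReal (Q.toGo s.2 i) := by
      intro turn ped
      rw [Q.ofReal_toGo_late hi hc _ (Q.update (i + 1) s a.1 a.2 turn ped).1.2]
      congr 1
      simp only [update, h1, if_false]
      split_ifs with h
      · rw [min_eq_right (hs h)]
      · simp
    simp only [key, PMF.expect_const]

theorem meanDepartures_eq_expect (x : ℕ) :
    Q.meanDepartures x = (Q.run (x, false) Q.c).expect fun z => (z.2 : ℝ≥0∞) := rfl

theorem meanDepartures_le (x : ℕ) : Q.meanDepartures x ≤ ENNReal.ofReal Q.r0 := by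
  have h := Q.expect_run_le (fun i s => ENNReal.ofReal (Q.toGo (s.2 || decide (s.1 = 0)) i)) Q.c
    (fun i hi s => Q.expect_slotLaw_toGo_le hi s) (x, false)
  simp only [toGo_c, ENNReal.ofReal_zero, add_zero] at h
  rw [meanDepartures_eq_expect, r0_eq_toGo]
  refine h.trans (ENNReal.ofReal_le_ofReal ?_)
  cases decide (x = 0)
  · exact le_rfl
  · exact (Q.toGo_bounds (Nat.zero_le _)).2

theorem meanDepartures_eq {x : ℕ} (hx : Q.m * (Q.g1 + Q.g2) ≤ x) :
    Q.meanDepartures x = ENNReal.ofReal Q.r0 := by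
  have h := Q.expect_run_eq (fun i s => ENNReal.ofReal (Q.toGo s.2 i)) Q.c (x, false)
    (fun i hi z hz => Q.expect_slotLaw_toGo_eq hi z.1 fun h => Q.m_le_of_mem_support_run hx hz h)
  simp only [toGo_c, ENNReal.ofReal_zero, add_zero] at h
  rw [meanDepartures_eq_expect, r0_eq_toGo, h]

theorem capacity_eq : Q.capacity = ENNReal.ofReal Q.r0 :=
  le_antisymm (iSup_le Q.meanDepartures_le)
    ((Q.meanDepartures_eq le_rfl).symm.le.trans (le_iSup Q.meanDepartures _))

/-! ### Stability -/

theorem expect_cycleKernel_le (x : ℕ) : (Q.cycleKernel x).expect (fun y => (y : ℝ≥0∞))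
    ≤ x + ∑ i ∈ Finset.Icc 1 Q.c, Q.meanArrivals i :=
  le_trans le_add_self (Q.meanDepartures_add_expect_cycleKernel_le x)

theorem expect_cycleKernel_add
    (h : ∑ i ∈ Finset.Icc 1 Q.c, Q.meanArrivals i < ENNReal.ofReal Q.r0) {x : ℕ}
    (hx : Q.m * (Q.g1 + Q.g2) ≤ x) :
    (Q.cycleKernel x).expect (fun y => (y : ℝ≥0∞))
      + (ENNReal.ofReal Q.r0 - ∑ i ∈ Finset.Icc 1 Q.c, Q.meanArrivals i) = x := by
  have h1 := Q.meanDepartures_add_expect_cycleKernel_eq hx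
  rw [Q.meanDepartures_eq hx] at h1
  rw [← ENNReal.add_left_inj h.ne_top, ← h1, add_assoc, tsub_add_cancel_of_le h.le, add_comm]

theorem isStable_of_lt
    (h : ∑ i ∈ Finset.Icc 1 Q.c, Q.meanArrivals i < ENNReal.ofReal Q.r0) : Q.IsStable := by
  refine ⟨Finset.range (Q.m * (Q.g1 + Q.g2)), meanReturnTime_lt_top_of_drift
    (tsub_pos_of_lt h).ne' (fun x => ?_) fun x hx => ?_⟩
  · exact ne_top_of_le_ne_top (ENNReal.add_ne_top.2 ⟨ENNReal.natCast_ne_top x, h.ne_top⟩)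
      (Q.expect_cycleKernel_le x)
  · rw [Finset.mem_range, not_lt] at hx
    exact (Q.expect_cycleKernel_add h hx).le

theorem IsStable.lt {Q : BFCTL} (hQ : Q.IsStable) :
    ∑ i ∈ Finset.Icc 1 Q.c, Q.meanArrivals i < ENNReal.ofReal Q.r0 := by
  by_contra h
  rw [not_lt] at h
  obtain ⟨C, hC⟩ := hQ
  obtain ⟨x, hx⟩ := exists_meanReturnTime_eq_top Q.cycleKernel C (Q.m * (Q.g1 + Q.g2))
    (Nat.mul_pos Q.m_pos (Nat.add_pos_right _ Q.g2_pos))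
    (fun x y hy => Q.le_add_of_mem_support_cycleKernel hy) fun x hx => by
      have h1 := Q.meanDepartures_add_expect_cycleKernel_eq hx
      rw [Q.meanDepartures_eq hx] at h1
      rw [← ENNReal.add_le_add_iff_left (ENNReal.ofReal_ne_top (r := Q.r0)), h1, add_comm]
      exact add_le_add_right h _
  exact (hC x).ne hx

theorem IsStable.exists_stationary {Q : BFCTL} (hQ : Q.IsStable) :
    ∃ π : PMF ℕ, π.bind Q.cycleKernel = π := by
  have h := hQ.lt
  set a := ∑ i ∈ Finset.Icc 1 Q.c, Q.meanArrivals i with ha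
  refine exists_stationary_of_drift Q.cycleKernel (Finset.range (Q.m * (Q.g1 + Q.g2)))
    -- Inside the finite set the mean rises by at most `a`, and the drift gap is at most `r0`; hence
    -- this `B`.
    (tsub_pos_of_lt h).ne' (B := ENNReal.ofReal Q.r0 + a)
    (ENNReal.add_ne_top.2 ⟨ENNReal.ofReal_ne_top, h.ne_top⟩) fun x => ?_
  split_ifs with hx
  · rw [add_comm (ENNReal.ofReal _) a, ← add_assoc]
    exact add_le_add (Q.expect_cycleKernel_le x) tsub_le_self
  · rw [Finset.mem_range, not_lt] at hx
    rw [add_zero]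
    exact (Q.expect_cycleKernel_add h hx).le

end BFCTL

theorem mainTheorem2 (Q : BFCTL) :
    (Q.capacity = ENNReal.ofReal Q.r0 ∧
      ∀ x : ℕ, Q.m * (Q.g1 + Q.g2) ≤ x → Q.meanDepartures x = ENNReal.ofReal Q.r0) ∧
    (Q.IsStable ↔ (∑ i ∈ Finset.Icc 1 Q.c, Q.meanArrivals i) < ENNReal.ofReal Q.r0) ∧
    (Q.IsStable → ∃ π : PMF ℕ, π.bind Q.cycleKernel = π) :=
  ⟨⟨Q.capacity_eq, fun _ hx => Q.meanDepartures_eq hx⟩,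
    ⟨BFCTL.IsStable.lt, Q.isStable_of_lt⟩, BFCTL.IsStable.exists_stationary⟩
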